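/- Let $\varphi(q)=\sum_{k\in\mathbb{Z}}q^{k^2}$ and $\psi(q)=\sum_{k\ge 0}q^{k(k+1)/2}$, regarded as formal power series with integer coefficients. Put $$F(q)=\frac{\varphi(-q^3)}{\varphi(-q)}=\sum_{n\ge 0}ph_3(n)q^n,\qquad G(q)=\frac{\psi(q^3)}{\psi(q)}=\sum_{n\ge 0}ps_3(n)q^n,$$ $$\xi(q)=\frac{\varphi(-q^9)}{\varphi(-q)},\qquad \zeta(q)=q\,\frac{\psi(q^9)}{\psi(q)}.$$ For $m\ge 1$ define $$\Phi_{2m-1}(q)=\frac{1}{F(q^3)}\sum_{n\ge 0}ph_3\big(3^{2m-1}n\big)q^n,\qquad \Phi_{2m}(q)=\frac{1}{F(q)}\sum_{n\ge 0}ph_3\big(3^{2m}n\big)q^n,$$ $$\Psi_{2m-1}(q)=\frac{1}{G(q^3)}\sum_{n\ge 0}ps_3\Big(3^{2m-1}n+\frac{3^{2m}-1}{4}\Big)q^n,\qquad \Psi_{2m}(q)=\frac{1}{G(q)}\sum_{n\ge 0}ps_3\Big(3^{2m}n+\frac{3^{2m}-1}{4}\Big)q^n.$$ Then for every $M\ge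 1$ the series $\Phi_M$ has a unique representation $\Phi_M=\sum_k c_M(k)\,\xi^k$ as a polynomial in $\xi$ with integer coefficients, and with the same coefficients $$\Psi_M=\sum_k c_M(k)\,\zeta^k .$$ -/

import Mathlib

/-- Ramanujan's `φ(q) = ∑_{k ∈ ℤ} q ^ (k ^ 2)` as a formal power series over `ℤ`: the coefficient
of `q ^ n` is the number of integers `k` with `k ^ 2 = n`. -/
noncomputable def thetaPhi : PowerSeries ℤ :=
  PowerSeries.mk fun n => (Nat.card {k : ℤ // k ^ 2 = (n : ℤ)} : ℤ)

/-- The series `φ(-q)`. -/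
noncomputable def thetaPhiNeg : PowerSeries ℤ :=
  PowerSeries.evalNegHom thetaPhi

/-- Ramanujan's `ψ(q) = ∑_{k ≥ 0} q ^ (k (k + 1) / 2)` as a formal power series over `ℤ`: the
coefficient of `q ^ n` is the number of natural numbers `k` with `k (k + 1) / 2 = n`. -/
noncomputable def thetaPsi : PowerSeries ℤ :=
  PowerSeries.mk fun n => (Nat.card {k : ℕ // k * (k + 1) / 2 = n} : ℤ)

/-- The substitution `f(q) ↦ f(q ^ 3)`. -/
noncomputable def subst3 (f : PowerSeries ℤ) : PowerSeries ℤ :=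
  PowerSeries.expand 3 (by norm_num) f

/-- The substitution `f(q) ↦ f(q ^ 9)`. -/
noncomputable def subst9 (f : PowerSeries ℤ) : PowerSeries ℤ :=
  PowerSeries.expand 9 (by norm_num) f

/-- The quotient `f / g` of integral power series, for `g` with constant term `1`. All the
denominators used below have constant term `1`. -/
noncomputable def psDiv (f g : PowerSeries ℤ) : PowerSeries ℤ :=
  f * PowerSeries.invOfUnit g 1

theorem psDiv_mul_cancel (f g : PowerSeries ℤ) (hg : PowerSeries.constantCoeff g = 1) :
    psDiv f g * g = f := by
  rw [psDiv, mul_assoc, PowerSeries.invOfUnit_mul g 1 (by simpa using hg), mul_one]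

theorem constantCoeff_psDiv (f g : PowerSeries ℤ) :
    PowerSeries.constantCoeff (psDiv f g) = PowerSeries.constantCoeff f := by
  simp [psDiv]

theorem constantCoeff_thetaPhi : PowerSeries.constantCoeff thetaPhi = 1 := by
  rw [← PowerSeries.coeff_zero_eq_constantCoeff_apply, thetaPhi, PowerSeries.coeff_mk]
  have : Unique {k : ℤ // k ^ 2 = ((0 : ℕ) : ℤ)} :=
    ⟨⟨⟨0, by simp⟩⟩, fun x => Subtype.ext (by simpa using x.2)⟩
  simp only [Nat.card_unique, Nat.cast_one]

theorem constantCoeff_thetaPhiNeg : PowerSeries.constantCoeff thetaPhiNeg = 1 := by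
  rw [← constantCoeff_thetaPhi, ← PowerSeries.coeff_zero_eq_constantCoeff_apply,
    ← PowerSeries.coeff_zero_eq_constantCoeff_apply, thetaPhiNeg, PowerSeries.evalNegHom,
    PowerSeries.coeff_rescale, pow_zero, one_mul]

theorem constantCoeff_thetaPsi : PowerSeries.constantCoeff thetaPsi = 1 := by
  rw [← PowerSeries.coeff_zero_eq_constantCoeff_apply, thetaPsi, PowerSeries.coeff_mk]
  have : Unique {k : ℕ // k * (k + 1) / 2 = 0} :=
    ⟨⟨⟨0, by simp⟩⟩, fun x => Subtype.ext (by
      have h := x.2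
      change x.1 = 0
      by_contra h0
      have h1 : 1 ≤ x.1 := Nat.one_le_iff_ne_zero.mpr h0
      have h2 : 2 ≤ x.1 * (x.1 + 1) := by nlinarith
      omega)⟩
  simp only [Nat.card_unique, Nat.cast_one]

/-- `F(q) = φ(-q ^ 3) / φ(-q)`. -/
noncomputable def serF : PowerSeries ℤ := psDiv (subst3 thetaPhiNeg) thetaPhiNeg

/-- `G(q) = ψ(q ^ 3) / ψ(q)`. -/
noncomputable def serG : PowerSeries ℤ := psDiv (subst3 thetaPsi) thetaPsi

theorem constantCoeff_serF : PowerSeries.constantCoeff serF = 1 := by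
  simp [serF, constantCoeff_psDiv, subst3, PowerSeries.constantCoeff_expand,
    constantCoeff_thetaPhiNeg]

theorem constantCoeff_serG : PowerSeries.constantCoeff serG = 1 := by
  simp [serG, constantCoeff_psDiv, subst3, PowerSeries.constantCoeff_expand,
    constantCoeff_thetaPsi]

/-- `ph_3(n)`, defined by `∑ ph_3(n) q ^ n = φ(-q ^ 3) / φ(-q)`. -/
noncomputable def ph3 (n : ℕ) : ℤ := PowerSeries.coeff n serF

/-- `ps_3(n)`, defined by `∑ ps_3(n) q ^ n = ψ(q ^ 3) / ψ(q)`. -/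
noncomputable def ps3 (n : ℕ) : ℤ := PowerSeries.coeff n serG

/-- `ξ(q) = φ(-q ^ 9) / φ(-q)`. -/
noncomputable def serXi : PowerSeries ℤ := psDiv (subst9 thetaPhiNeg) thetaPhiNeg

/-- `ζ(q) = q ψ(q ^ 9) / ψ(q)`. -/
noncomputable def serZeta : PowerSeries ℤ := PowerSeries.X * psDiv (subst9 thetaPsi) thetaPsi

/-- `Φ_M(q)`: for `M = 2m - 1` it is `F(q ^ 3)⁻¹ ∑ ph_3(3 ^ (2m - 1) n) q ^ n`, and for `M = 2m`
it is `F(q)⁻¹ ∑ ph_3(3 ^ (2m) n) q ^ n`. -/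
noncomputable def serPhi (M : ℕ) : PowerSeries ℤ :=
  psDiv (PowerSeries.mk fun n => ph3 (3 ^ M * n)) (if Even M then serF else subst3 serF)

/-- `Ψ_M(q)`: for `M = 2m - 1` it is
`G(q ^ 3)⁻¹ ∑ ps_3(3 ^ (2m - 1) n + (3 ^ (2m) - 1) / 4) q ^ n`, and for `M = 2m` it is
`G(q)⁻¹ ∑ ps_3(3 ^ (2m) n + (3 ^ (2m) - 1) / 4) q ^ n`. In both cases `m = (M + 1) / 2` rounded
down, and `(3 ^ (2m) - 1) / 4` is an exact quotient of natural numbers. -/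
noncomputable def serPsi (M : ℕ) : PowerSeries ℤ :=
  psDiv (PowerSeries.mk fun n => ps3 (3 ^ M * n + (3 ^ (2 * ((M + 1) / 2)) - 1) / 4))
    (if Even M then serG else subst3 serG)

/-! Let U send ∑ f(n) q^n to ∑ f(3n) q^n. Since U(f(q³) g) = f U(g), and F(q) F(q³) = ξ, q G(q)
G(q³) = ζ, passing from Φ_M = P(ξ) to Φ_{M+1} = Q(ξ) means Q(ξ) = U(P(ξ)) for odd M and ξ Q(ξ) = U(ξ
P(ξ)) for even M; the same holds for Ψ_M and ζ. It therefore suffices that U acts on polynomials in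
ξ and in ζ by one and the same rule.

That rule is `IsCubicHauptmodul`: with D = x - 3x² + 3x³, a cubic equation x³ = D(q³)(1 - 3x + 3x²)
and the values of U(x), U(x²). The cubic gives a recurrence for U(x^k), hence the rule on all
polynomials.

The relations come from y = φ(-q) or ψ(q), whose 3-dissection has only two terms, y = A + qB with A,
B series in q³. Here A = φ(-q⁹) in the first case and B = ψ(q⁹) in the second, so x is A/y or qB/y.
Gauss's infinite products give, for both y, y(q) y(ωq) y(ω²q) = y(q³)⁴ / y(q⁹), and the left side is
A³ + q³B³. The two cases differ by exchanging x and 1 - x, and 1 - 3x + 3x² = x³ + (1 - x)³ is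
symmetric, so ξ and ζ obey identical relations.

Uniqueness holds because a nonconstant power series is transcendental over ℤ. -/

/-! ### Finite forms of Gauss's product identities -/

section FiniteGauss

open Finset

variable {R : Type*} [CommRing R] (q : R)

/-- The finite form of Gauss's product for `φ(-q)`, one step, up to the `m`-th summand. -/
theorem gauss_square_step (n m : ℕ) (hm : m ≤ n) :
    ∑ s ∈ range (m + 1), (-1) ^ s * (∏ k ∈ range s, (1 + q ^ k)) * q ^ (s * (n + 2)) *
        ∏ k ∈ Ico s (n + 1), (1 - q ^ (k + 1)) =
      (1 + q ^ (n + 1)) * ∑ s ∈ range (m + 1), (-1) ^ s * (∏ k ∈ range s, (1 + q ^ k)) *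
        q ^ (s * (n + 1)) * ∏ k ∈ Ico s n, (1 - q ^ (k + 1)) -
      (-1) ^ m * (∏ k ∈ range (m + 1), (1 + q ^ k)) * q ^ ((m + 1) * (n + 1)) *
        ∏ k ∈ Ico m n, (1 - q ^ (k + 1)) := by
  induction m with
  | zero =>
    simp only [zero_add, sum_range_one, pow_zero, prod_range_zero, zero_mul, mul_one, one_mul,
      prod_range_one]
    rw [prod_Ico_succ_top (Nat.zero_le n)]
    ring
  | succ m ih =>
    rw [sum_range_succ, ih (by omega), sum_range_succ _ (m + 1), prod_eq_prod_Ico_succ_bot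
      (show m < n by omega), prod_Ico_succ_top (show m + 1 ≤ n by omega),
      prod_range_succ _ (m + 1)]
    ring

/-- The summand s = 0 is ∏ (1 - q^(k+1)) and every other one is divisible by q^(n+1), so Gauss's
product for φ(-q) follows modulo q^n. -/
theorem gauss_square_finite (n : ℕ) :
    (∏ k ∈ range n, (1 + q ^ (k + 1))) *
        (1 + 2 * ∑ s ∈ range n, (-1) ^ (s + 1) * q ^ ((s + 1) ^ 2)) =
      ∑ s ∈ range (n + 1), (-1) ^ s * (∏ k ∈ range s, (1 + q ^ k)) * q ^ (s * (n + 1)) *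
        ∏ k ∈ Ico s n, (1 - q ^ (k + 1)) := by
  induction n with
  | zero => simp
  | succ n ih =>
    rw [sum_range_succ _ (n + 1), gauss_square_step q n n le_rfl, ← ih, prod_range_succ,
      sum_range_succ, prod_range_succ' _ n]
    simp only [Ico_self, prod_empty]
    ring

/-- The finite form of Gauss's product for `ψ(q)`, one step, up to the `m`-th summand. -/
theorem gauss_triangle_step (n m : ℕ) (hm : m ≤ n) :
    ∑ s ∈ range m, (∏ k ∈ range s, (1 - q ^ (2 * k + 1))) * q ^ (s * (2 * n + 3)) *
        ∏ k ∈ Ico s (n + 1), (1 - q ^ (2 * k + 2)) =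
      (1 - q ^ (2 * n + 1)) * ∑ s ∈ range m, (∏ k ∈ range s, (1 - q ^ (2 * k + 1))) *
        q ^ (s * (2 * n + 1)) * ∏ k ∈ Ico s n, (1 - q ^ (2 * k + 2)) +
      (1 - q ^ (2 * m)) * (∏ k ∈ range m, (1 - q ^ (2 * k + 1))) * q ^ (m * (2 * n + 1)) *
        ∏ k ∈ Ico m n, (1 - q ^ (2 * k + 2)) := by
  induction m with
  | zero => simp
  | succ m ih =>
    rw [sum_range_succ, ih (by omega), sum_range_succ _ m, prod_eq_prod_Ico_succ_bot
      (show m < n by omega), prod_Ico_succ_top (show m ≤ n by omega), prod_eq_prod_Ico_succ_bot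
      (show m < n by omega), prod_range_succ _ m]
    ring

/-- For n ≥ 1 only the summand s = 0 survives modulo q^n, which leaves the product for ψ(q). -/
theorem gauss_triangle_finite (n : ℕ) :
    (∏ k ∈ range n, (1 - q ^ (2 * k + 1))) * ∑ s ∈ range (2 * n), q ^ (s * (s + 1) / 2) =
      ∑ s ∈ range n, (∏ k ∈ range s, (1 - q ^ (2 * k + 1))) * q ^ (s * (2 * n + 1)) *
        ∏ k ∈ Ico s n, (1 - q ^ (2 * k + 2)) := by
  induction n with
  | zero => simp
  | succ n ih =>
    have h1 : 2 * n * (2 * n + 1) / 2 = n * (2 * n + 1) := by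
      rw [mul_assoc, Nat.mul_div_cancel_left _ two_pos]
    have h2 : (2 * n + 1) * (2 * n + 1 + 1) / 2 = (2 * n + 1) * (n + 1) := by
      rw [show (2 * n + 1) * (2 * n + 1 + 1) = 2 * ((2 * n + 1) * (n + 1)) by ring,
        Nat.mul_div_cancel_left _ two_pos]
    rw [sum_range_succ _ n, show 2 * (n + 1) + 1 = 2 * n + 3 by ring,
      gauss_triangle_step q n n le_rfl, ← ih, prod_range_succ,
      show 2 * (n + 1) = 2 * n + 1 + 1 by ring, sum_range_succ, sum_range_succ, h1, h2,
      prod_Ico_succ_top le_rfl]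
    simp only [Ico_self, prod_empty]
    ring

end FiniteGauss

/-! ### Norms over the cube roots of unity -/

section CubeNorm

open PowerSeries Finset

variable {R : Type*} [CommRing R]

/-- The product `f(q) f(ωq) f(ω²q)`; for a primitive cube root of unity `ω` this is the norm of `f`
over the ring of power series in `q ^ 3`. -/
noncomputable def cubeNorm (ω : R) (f : R⟦X⟧) : R⟦X⟧ :=
  f * rescale ω f * rescale (ω ^ 2) f

theorem cubeNorm_mul (ω : R) (f g : R⟦X⟧) :
    cubeNorm ω (f * g) = cubeNorm ω f * cubeNorm ω g := by
  simp only [cubeNorm, map_mul]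
  ring

theorem cubeNorm_one (ω : R) : cubeNorm ω (1 : R⟦X⟧) = 1 := by
  simp [cubeNorm]

theorem rescale_C_apply (a c : R) : rescale a (C c) = C c := by
  ext n
  rw [coeff_rescale, coeff_C]
  split_ifs with h
  · simp [h]
  · simp

theorem X_pow_dvd_rescale (a : R) {f : R⟦X⟧} {n : ℕ} (h : X ^ n ∣ f) :
    X ^ n ∣ rescale a f := by
  rw [X_pow_dvd_iff] at h ⊢
  intro m hm
  rw [coeff_rescale, h m hm, mul_zero]

theorem X_pow_dvd_expand {p : ℕ} (hp : p ≠ 0) {f : R⟦X⟧} {n : ℕ} (h : X ^ n ∣ f) :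
    X ^ n ∣ expand p hp f := by
  rw [X_pow_dvd_iff] at h ⊢
  intro m hm
  rw [coeff_expand]
  split_ifs
  · exact h _ ((Nat.div_le_self m p).trans_lt hm)
  · rfl

/-- Congruence modulo `X ^ n` is equality in the quotient ring. -/
theorem mk_span_X_pow_eq_iff {n : ℕ} {f g : R⟦X⟧} :
    Ideal.Quotient.mk (Ideal.span {(X : R⟦X⟧) ^ n}) f = Ideal.Quotient.mk _ g ↔
      X ^ n ∣ f - g := by
  rw [Ideal.Quotient.eq, Ideal.mem_span_singleton]

theorem eq_of_forall_X_pow_dvd_sub {f g : R⟦X⟧} (h : ∀ n : ℕ, X ^ n ∣ f - g) : f = g := by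
  ext n
  have := X_pow_dvd_iff.1 (h (n + 1)) n (Nat.lt_succ_self n)
  rwa [map_sub, sub_eq_zero] at this

theorem X_pow_dvd_cubeNorm_sub (ω : R) {f g : R⟦X⟧} {n : ℕ} (h : X ^ n ∣ f - g) :
    X ^ n ∣ cubeNorm ω f - cubeNorm ω g := by
  rw [← mk_span_X_pow_eq_iff]
  have h1 := mk_span_X_pow_eq_iff.2 h
  have h2 := X_pow_dvd_rescale ω h
  have h3 := X_pow_dvd_rescale (ω ^ 2) h
  rw [map_sub, ← mk_span_X_pow_eq_iff] at h2 h3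
  simp only [cubeNorm, map_mul, h1, h2, h3]

theorem cubeNorm_one_sub_of_dvd {ω : R} (hω : ω ^ 3 = 1) (c : R) {m : ℕ} (hm : 3 ∣ m) :
    cubeNorm ω (1 - C c * X ^ m) = (1 - C c * X ^ m) ^ 3 := by
  obtain ⟨j, rfl⟩ := hm
  have h : ∀ a : R, a ^ 3 = 1 →
      rescale a (1 - C c * X ^ (3 * j)) = 1 - C c * (X : R⟦X⟧) ^ (3 * j) := by
    intro a ha
    rw [map_sub, map_one, map_mul, map_pow, rescale_C_apply, rescale_X, mul_pow, ← map_pow,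
      pow_mul a, ha, one_pow, map_one, one_mul]
  rw [cubeNorm, h ω hω, h (ω ^ 2) (by rw [← pow_mul, mul_comm, pow_mul, hω, one_pow])]
  ring

theorem cubeNorm_one_sub_of_not_dvd {ω : R} (hω : 1 + ω + ω ^ 2 = 0) {c : R} (hc : c ^ 3 = c)
    {m : ℕ} (hm : ¬ 3 ∣ m) :
    cubeNorm ω (1 - C c * X ^ m) = expand 3 three_ne_zero (1 - C c * X ^ m) := by
  have h3 : ω ^ 3 = 1 := by linear_combination (ω - 1) * hω
  have hr : ∀ a : R, rescale a (1 - C c * X ^ m) = 1 - C (a ^ m) * (C c * (X : R⟦X⟧) ^ m) := by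
    intro a
    rw [map_sub, map_one, map_mul, map_pow, rescale_C_apply, rescale_X, mul_pow, ← map_pow]
    ring
  have hE : expand 3 three_ne_zero (1 - C c * (X : R⟦X⟧) ^ m) = 1 - (C c * X ^ m) ^ 3 := by
    rw [map_sub, map_one, map_mul, map_pow, expand_C, expand_X, mul_pow, ← map_pow, hc, ← pow_mul,
      ← pow_mul, mul_comm 3]
  have hs : 1 + (C ω : R⟦X⟧) + C ω ^ 2 = 0 := by
    rw [← map_pow, ← map_one (C (R := R)), ← map_add, ← map_add, hω, map_zero]
  have ht : (C ω : R⟦X⟧) ^ 3 = 1 := by rw [← map_pow, h3, map_one]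
  have key : ∀ x z : R⟦X⟧, 1 + z + z ^ 2 = 0 → (1 - x) * (1 - z * x) * (1 - z ^ 2 * x) =
      1 - x ^ 3 := by
    intro x z hz
    linear_combination (-x + z * x ^ 2 - (z - 1) * x ^ 3) * hz
  rw [cubeNorm, hr, hr, hE, ← pow_mul, mul_comm 2, pow_mul, map_pow (C (R := R)) (ω ^ m) 2]
  -- For m prime to 3, ω^m is again a root of 1 + z + z², so the three factors multiply to 1 - x³.
  apply key
  rw [map_pow]
  have hm' : m = 3 * (m / 3) + m % 3 := (Nat.div_add_mod m 3).symm
  have h12 : m % 3 = 1 ∨ m % 3 = 2 := by omega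
  rw [hm', pow_add, pow_mul, ht, one_pow, one_mul]
  rcases h12 with h | h <;> rw [h]
  · simpa using hs
  · linear_combination hs + C ω * ht

/-- The relation between `∏ u i`, its norm and its substitutions follows from the relation on blocks
of three consecutive factors. -/
theorem cubeNorm_prod_block (ω : R) (u : ℕ → R⟦X⟧)
    (h : ∀ i, cubeNorm ω (u (3 * i) * u (3 * i + 1) * u (3 * i + 2)) *
        expand 9 (by norm_num) (u i) =
      expand 3 three_ne_zero (u (3 * i) * u (3 * i + 1) * u (3 * i + 2)) *
        expand 3 three_ne_zero (u i) ^ 3) (n : ℕ) :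
    cubeNorm ω (∏ i ∈ range (3 * n), u i) * expand 9 (by norm_num) (∏ i ∈ range n, u i) =
      expand 3 three_ne_zero (∏ i ∈ range (3 * n), u i) *
        expand 3 three_ne_zero (∏ i ∈ range n, u i) ^ 3 := by
  induction n with
  | zero => simp [cubeNorm_one]
  | succ n ih =>
    have hb : ∏ i ∈ range (3 * (n + 1)), u i =
        (∏ i ∈ range (3 * n), u i) * (u (3 * n) * u (3 * n + 1) * u (3 * n + 2)) := by
      rw [show 3 * (n + 1) = 3 * n + 1 + 1 + 1 by ring, prod_range_succ, prod_range_succ,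
        prod_range_succ]
      ring
    have hB := h n
    rw [hb, prod_range_succ _ n]
    generalize u (3 * n) * u (3 * n + 1) * u (3 * n + 2) = B at hB ⊢
    simp only [cubeNorm_mul, map_mul]
    linear_combination (cubeNorm ω B * expand 9 (by norm_num) (u n)) * ih +
      (expand 3 three_ne_zero (∏ i ∈ range (3 * n), u i) *
        expand 3 three_ne_zero (∏ i ∈ range n, u i) ^ 3) * hB

/-- In each block of three exponents exactly one is a multiple of 3, and it is 3 e(i). Its factor
has a cube as norm, where the other two merely undergo q ↦ q³; the surplus is what the products over
`range n` record. -/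
theorem cubeNorm_prod_of_residue {ω : R} (hω : 1 + ω + ω ^ 2 = 0) {c : R} (hc : c ^ 3 = c)
    (e : ℕ → ℕ)
    (he : ∀ i, (e (3 * i + 1) = 3 * e i ∧ ¬ 3 ∣ e (3 * i + 2) ∨
      e (3 * i + 2) = 3 * e i ∧ ¬ 3 ∣ e (3 * i + 1)) ∧ ¬ 3 ∣ e (3 * i)) (n : ℕ) :
    cubeNorm ω (∏ i ∈ range (3 * n), (1 - C c * X ^ e i)) *
        expand 9 (by norm_num) (∏ i ∈ range n, (1 - C c * X ^ e i)) =
      expand 3 three_ne_zero (∏ i ∈ range (3 * n), (1 - C c * X ^ e i)) *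
        expand 3 three_ne_zero (∏ i ∈ range n, (1 - C c * X ^ e i)) ^ 3 := by
  have h3 : ω ^ 3 = 1 := by linear_combination (ω - 1) * hω
  have hE : ∀ (p : ℕ) (hp : p ≠ 0) (m : ℕ), expand p hp (1 - C c * (X : R⟦X⟧) ^ m) =
      1 - C c * X ^ (p * m) := by
    intro p hp m
    rw [map_sub, map_one, map_mul, map_pow, expand_C, expand_X, ← pow_mul]
  refine cubeNorm_prod_block ω _ (fun i => ?_) n
  obtain ⟨h12, h0⟩ := he i
  rw [cubeNorm_mul, cubeNorm_mul, map_mul, map_mul, cubeNorm_one_sub_of_not_dvd hω hc h0]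
  rcases h12 with ⟨h1, h2⟩ | ⟨h2, h1⟩
  · rw [cubeNorm_one_sub_of_not_dvd hω hc h2, cubeNorm_one_sub_of_dvd h3 c ⟨_, h1⟩]
    simp only [hE, h1, ← mul_assoc]
    ring
  · rw [cubeNorm_one_sub_of_not_dvd hω hc h1, cubeNorm_one_sub_of_dvd h3 c ⟨_, h2⟩]
    simp only [hE, h2, ← mul_assoc]
    ring

/-- If `y` is the infinite product `∏ u i / ∏ v i`, the relation of `cubeNorm_prod_block` passes
to `y`. -/
theorem cubeNorm_eq_of_approx (ω : R) (y : R⟦X⟧) (f g : ℕ → R⟦X⟧)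
    (hy : ∀ n : ℕ, X ^ n ∣ y * g n - f n) (hg : ∀ n, constantCoeff (g n) = 1)
    (hf3 : ∀ n, cubeNorm ω (f (3 * n)) * expand 9 (by norm_num) (f n) =
      expand 3 three_ne_zero (f (3 * n)) * expand 3 three_ne_zero (f n) ^ 3)
    (hg3 : ∀ n, cubeNorm ω (g (3 * n)) * expand 9 (by norm_num) (g n) =
      expand 3 three_ne_zero (g (3 * n)) * expand 3 three_ne_zero (g n) ^ 3) :
    cubeNorm ω y * expand 9 (by norm_num) y = expand 3 three_ne_zero y ^ 4 := by
  refine eq_of_forall_X_pow_dvd_sub fun n => ?_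
  have hn3 : X ^ n ∣ y * g (3 * n) - f (3 * n) :=
    (pow_dvd_pow X (by omega)).trans (hy (3 * n))
  have a1 := X_pow_dvd_cubeNorm_sub ω hn3
  have a2 := X_pow_dvd_expand (p := 9) (by norm_num) (hy n)
  have a3 := X_pow_dvd_expand (p := 3) (by norm_num) (hy n)
  have a4 := X_pow_dvd_expand (p := 3) (by norm_num) hn3
  rw [map_sub, ← mk_span_X_pow_eq_iff] at a2 a3 a4
  rw [← mk_span_X_pow_eq_iff] at a1
  rw [cubeNorm_mul] at a1
  rw [map_mul] at a2 a3 a4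
  set k := Ideal.Quotient.mk (Ideal.span {(X : R⟦X⟧) ^ n})
  have key : k (cubeNorm ω y * expand 9 (by norm_num) y *
        (cubeNorm ω (g (3 * n)) * expand 9 (by norm_num) (g n))) =
      k (expand 3 three_ne_zero y ^ 4 *
        (cubeNorm ω (g (3 * n)) * expand 9 (by norm_num) (g n))) := by
    have b1 := congrArg k (hf3 n)
    have b2 := congrArg k (hg3 n)
    simp only [map_mul, map_pow] at a1 a2 a3 a4 b1 b2 ⊢
    rw [← a1, ← a2, ← a3, ← a4] at b1
    linear_combination b1 - k (expand 3 three_ne_zero y) ^ 4 * b2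
  -- The denominators have constant term 1, so they cancel modulo q^n.
  have hc : IsUnit (cubeNorm ω (g (3 * n)) * expand 9 (by norm_num) (g n)) := by
    rw [isUnit_iff_constantCoeff]
    have hr : ∀ a : R, constantCoeff (rescale a (g (3 * n))) = 1 := by
      intro a
      rw [← coeff_zero_eq_constantCoeff_apply, coeff_rescale, pow_zero, one_mul,
        coeff_zero_eq_constantCoeff_apply, hg]
    simp only [cubeNorm, map_mul, constantCoeff_expand, hg, hr, mul_one, isUnit_one]
  rw [mk_span_X_pow_eq_iff, ← sub_mul] at key
  exact hc.dvd_mul_right.1 key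

end CubeNorm

/-! ### Coefficients of the theta series -/

section ThetaCoefficients

theorem coeff_thetaPhi_sq (r : ℕ) (hr : r ≠ 0) : PowerSeries.coeff (r ^ 2) thetaPhi = 2 := by
  rw [thetaPhi, PowerSeries.coeff_mk]
  have h : Nat.card {k : ℤ // k ^ 2 = ((r ^ 2 : ℕ) : ℤ)} = ({(r : ℤ), -(r : ℤ)} : Finset ℤ).card :=
    Nat.subtype_card _ fun k => by
      push_cast
      rw [Finset.mem_insert, Finset.mem_singleton, sq_eq_sq_iff_eq_or_eq_neg]
  rw [h, Finset.card_pair (by omega)]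
  rfl

theorem coeff_thetaPhi_of_not_isSquare (n : ℕ) (hn : ¬ IsSquare n) :
    PowerSeries.coeff n thetaPhi = 0 := by
  rw [thetaPhi, PowerSeries.coeff_mk]
  have : IsEmpty {k : ℤ // k ^ 2 = (n : ℤ)} := ⟨fun k => hn ⟨k.1.natAbs, by
    have := k.2
    zify
    rw [abs_mul_abs_self, ← sq, this]⟩⟩
  simp

theorem coeff_thetaPhiNeg (n : ℕ) :
    PowerSeries.coeff n thetaPhiNeg = (-1) ^ n * PowerSeries.coeff n thetaPhi := by
  rw [thetaPhiNeg, PowerSeries.evalNegHom, PowerSeries.coeff_rescale]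

theorem coeff_thetaPsi (n N : ℕ) (h : n < N) :
    PowerSeries.coeff n thetaPsi = ∑ s ∈ Finset.range N, if n = s * (s + 1) / 2 then 1 else 0 := by
  rw [thetaPsi, PowerSeries.coeff_mk, ← Finset.sum_filter, Finset.sum_const, nsmul_one]
  congr 1
  refine Nat.subtype_card _ fun k => ?_
  rw [Finset.mem_filter, Finset.mem_range]
  refine ⟨fun hk => hk.2.symm, fun hk => ⟨?_, hk.symm⟩⟩
  rcases k with _ | k
  · omega
  · have : (k + 1) * 2 ≤ (k + 1) * (k + 1 + 1) := Nat.mul_le_mul_left _ (by omega)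
    omega

end ThetaCoefficients

/-! ### Gauss's products and the norms of φ(-q) and ψ(q) -/

section GaussProducts

open PowerSeries Finset

theorem X_pow_dvd_thetaPhiNeg_sub (n : ℕ) :
    (X : ℤ⟦X⟧) ^ n ∣
      thetaPhiNeg - (1 + 2 * ∑ s ∈ range n, (-1) ^ (s + 1) * X ^ ((s + 1) ^ 2)) := by
  rw [X_pow_dvd_iff]
  intro m hm
  have hc : coeff m (1 + 2 * ∑ s ∈ range n, (-1) ^ (s + 1) * (X : ℤ⟦X⟧) ^ ((s + 1) ^ 2)) =
      (if m = 0 then 1 else 0) +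
        2 * ∑ s ∈ range n, (-1) ^ (s + 1) * if m = (s + 1) ^ 2 then 1 else 0 := by
    have h2 : (2 : ℤ⟦X⟧) = C 2 := by simp
    have h1 : ∀ s : ℕ, (-1 : ℤ⟦X⟧) ^ (s + 1) = C ((-1) ^ (s + 1)) := fun s => by simp
    rw [map_add, coeff_one, h2, coeff_C_mul, map_sum]
    simp only [h1, coeff_C_mul, coeff_X_pow]
  rw [map_sub, hc, sub_eq_zero, coeff_thetaPhiNeg]
  by_cases hs : IsSquare m
  · obtain ⟨r, rfl⟩ := hs
    rw [← sq] at hm ⊢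
    rcases r with _ | r
    · have : coeff 0 thetaPhi = 1 := by
        rw [coeff_zero_eq_constantCoeff_apply, constantCoeff_thetaPhi]
      have hz : ∀ x : ℕ, ¬ 0 = (x + 1) ^ 2 := fun x => by positivity
      simp [this, hz]
    · have hr : r < n := by
        have : r + 1 ≤ (r + 1) ^ 2 := Nat.le_self_pow two_ne_zero _
        omega
      rw [coeff_thetaPhi_sq _ (Nat.succ_ne_zero r), if_neg (by positivity),
        Finset.sum_eq_single r]
      · have hp : (-1 : ℤ) ^ ((r + 1) ^ 2) = (-1) ^ (r + 1) := by
          rcases Nat.even_or_odd (r + 1) with h | h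
          · rw [h.neg_one_pow, (h.pow_of_ne_zero two_ne_zero).neg_one_pow]
          · rw [h.neg_one_pow, h.pow.neg_one_pow]
        rw [hp, if_pos rfl]
        ring
      · intro b _ hb
        rw [if_neg, mul_zero]
        intro h
        have := Nat.pow_left_injective two_ne_zero h
        omega
      · intro h
        exact absurd (Finset.mem_range.2 hr) h
  · rw [coeff_thetaPhi_of_not_isSquare m hs, if_neg, Finset.sum_eq_zero]
    · simp
    · intro s _
      rw [if_neg, mul_zero]
      rintro rfl
      exact hs ⟨s + 1, sq _⟩
    · rintro rfl
      exact hs ⟨0, rfl⟩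

theorem X_pow_dvd_thetaPsi_sub (n : ℕ) :
    (X : ℤ⟦X⟧) ^ n ∣ thetaPsi - ∑ s ∈ range (2 * n), X ^ (s * (s + 1) / 2) := by
  rw [X_pow_dvd_iff]
  intro m hm
  rw [map_sub, sub_eq_zero, coeff_thetaPsi m (2 * n) (by omega), map_sum]
  simp only [coeff_X_pow]

/-- Gauss: `φ(-q) = ∏ (1 - q ^ k) / (1 + q ^ k)`. -/
theorem thetaPhiNeg_gauss (n : ℕ) :
    (X : ℤ⟦X⟧) ^ n ∣ thetaPhiNeg * (∏ k ∈ range n, (1 + X ^ (k + 1))) -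
      ∏ k ∈ range n, (1 - X ^ (k + 1)) := by
  have h1 := (X_pow_dvd_thetaPhiNeg_sub n).mul_right (∏ k ∈ range n, (1 + (X : ℤ⟦X⟧) ^ (k + 1)))
  have h2 := gauss_square_finite (X : ℤ⟦X⟧) n
  rw [sum_range_succ'] at h2
  simp only [pow_zero, prod_range_zero, zero_mul, mul_one, one_mul, ← Finset.range_eq_Ico] at h2
  have h3 : (X : ℤ⟦X⟧) ^ n ∣ ∑ s ∈ range n, (-1) ^ (s + 1) * (∏ k ∈ range (s + 1), (1 + X ^ k)) *
      X ^ ((s + 1) * (n + 1)) * ∏ k ∈ Ico (s + 1) n, (1 - X ^ (k + 1)) := by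
    refine Finset.dvd_sum fun s _ => Dvd.dvd.mul_right (Dvd.dvd.mul_left (pow_dvd_pow X ?_) _) _
    nlinarith
  convert dvd_add h1 h3 using 1
  linear_combination h2

/-- Gauss: `ψ(q) = ∏ (1 - q ^ (2k)) / (1 - q ^ (2k - 1))`. -/
theorem thetaPsi_gauss (n : ℕ) :
    (X : ℤ⟦X⟧) ^ n ∣ thetaPsi * (∏ k ∈ range n, (1 - X ^ (2 * k + 1))) -
      ∏ k ∈ range n, (1 - X ^ (2 * k + 2)) := by
  have h1 := (X_pow_dvd_thetaPsi_sub n).mul_right (∏ k ∈ range n, (1 - (X : ℤ⟦X⟧) ^ (2 * k + 1)))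
  have h2 := gauss_triangle_finite (X : ℤ⟦X⟧) n
  rcases n with _ | n
  · simp
  rw [sum_range_succ' _ n] at h2
  simp only [pow_zero, prod_range_zero, zero_mul, mul_one, one_mul, ← Finset.range_eq_Ico] at h2
  have h3 : (X : ℤ⟦X⟧) ^ (n + 1) ∣ ∑ s ∈ range n, (∏ k ∈ range (s + 1), (1 - X ^ (2 * k + 1))) *
      X ^ ((s + 1) * (2 * (n + 1) + 1)) * ∏ k ∈ Ico (s + 1) (n + 1), (1 - X ^ (2 * k + 2)) := by
    refine Finset.dvd_sum fun s _ => Dvd.dvd.mul_right (Dvd.dvd.mul_left (pow_dvd_pow X ?_) _) _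
    nlinarith
  convert dvd_add h1 h3 using 1
  linear_combination h2

theorem exists_one_add_add_sq_eq_zero : ∃ ω : ℂ, 1 + ω + ω ^ 2 = 0 := by
  obtain ⟨ω, h⟩ := Complex.isSquare (-3 : ℂ)
  exact ⟨(ω - 1) / 2, by linear_combination -(1 / 4) * h⟩

theorem cubeNorm_thetaPhiNeg {ω : ℂ} (hω : 1 + ω + ω ^ 2 = 0) :
    cubeNorm ω (map (Int.castRingHom ℂ) thetaPhiNeg) *
        expand 9 (by norm_num) (map (Int.castRingHom ℂ) thetaPhiNeg) =
      expand 3 three_ne_zero (map (Int.castRingHom ℂ) thetaPhiNeg) ^ 4 := by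
  refine cubeNorm_eq_of_approx ω _ (fun n => ∏ k ∈ range n, (1 - C 1 * X ^ (k + 1)))
    (fun n => ∏ k ∈ range n, (1 - C (-1) * X ^ (k + 1))) (fun n => ?_) (fun n => ?_)
    (cubeNorm_prod_of_residue hω (c := 1) (by norm_num) (fun k => k + 1) fun i => by omega)
    (cubeNorm_prod_of_residue hω (c := -1) (by norm_num) (fun k => k + 1) fun i => by omega)
  · have h := map_dvd (PowerSeries.map (Int.castRingHom ℂ)) (thetaPhiNeg_gauss n)
    simpa [map_prod] using h
  · simp [map_prod]

theorem cubeNorm_thetaPsi {ω : ℂ} (hω : 1 + ω + ω ^ 2 = 0) :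
    cubeNorm ω (map (Int.castRingHom ℂ) thetaPsi) *
        expand 9 (by norm_num) (map (Int.castRingHom ℂ) thetaPsi) =
      expand 3 three_ne_zero (map (Int.castRingHom ℂ) thetaPsi) ^ 4 := by
  refine cubeNorm_eq_of_approx ω _ (fun n => ∏ k ∈ range n, (1 - C 1 * X ^ (2 * k + 2)))
    (fun n => ∏ k ∈ range n, (1 - C 1 * X ^ (2 * k + 1))) (fun n => ?_) (fun n => ?_)
    (cubeNorm_prod_of_residue hω (c := 1) (by norm_num) (fun k => 2 * k + 2) fun i => by omega)
    (cubeNorm_prod_of_residue hω (c := 1) (by norm_num) (fun k => 2 * k + 1) fun i => by omega)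
  · have h := map_dvd (PowerSeries.map (Int.castRingHom ℂ)) (thetaPsi_gauss n)
    simpa [map_prod] using h
  · simp [map_prod]

end GaussProducts

/-! ### 3-dissections of φ(-q) and ψ(q) -/

section Dissection

open PowerSeries

theorem rescale_expand_three {R : Type*} [CommRing R] {ω : R} (h : ω ^ 3 = 1) (f : R⟦X⟧) :
    rescale ω (expand 3 three_ne_zero f) = expand 3 three_ne_zero f := by
  ext n
  rw [coeff_rescale, coeff_expand]
  split_ifs with hn
  · obtain ⟨k, rfl⟩ := hn
    rw [pow_mul, h, one_pow, one_mul]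
  · rw [mul_zero]

theorem coeff_X_sq_mul (n : ℕ) (f : ℤ⟦X⟧) : coeff (n + 2) (X ^ 2 * f) = coeff n f :=
  coeff_X_pow_mul f 2 n

/-- Decomposition of a power series according to the residues of the exponents modulo `3`. -/
theorem eq_expand_three_add (f : ℤ⟦X⟧) :
    f = expand 3 three_ne_zero (mk fun n => coeff (3 * n) f) +
      X * expand 3 three_ne_zero (mk fun n => coeff (3 * n + 1) f) +
      X ^ 2 * expand 3 three_ne_zero (mk fun n => coeff (3 * n + 2) f) := by
  ext n
  have h : n = 3 * (n / 3) ∨ n = 3 * (n / 3) + 1 ∨ n = 3 * (n / 3) + 2 := by omega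
  generalize n / 3 = k at h
  rw [map_add, map_add]
  rcases h with rfl | rfl | rfl
  · rw [coeff_expand_mul, coeff_mk]
    rcases k with _ | k
    · simp
    · rw [show 3 * (k + 1) = 3 * k + 2 + 1 by ring, coeff_succ_X_mul,
        coeff_expand_of_not_dvd _ _ _ (by omega), show 3 * k + 2 + 1 = 3 * k + 1 + 2 by ring,
        coeff_X_sq_mul, coeff_expand_of_not_dvd _ _ _ (by omega)]
      ring
  · rw [coeff_succ_X_mul, coeff_expand_mul, coeff_mk, coeff_expand_of_not_dvd _ _ _ (by omega)]
    rcases k with _ | k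
    · simp [coeff_X_pow_mul']
    · rw [show 3 * (k + 1) + 1 = 3 * k + 2 + 2 by ring, coeff_X_sq_mul,
        coeff_expand_of_not_dvd _ _ _ (by omega)]
      ring
  · rw [coeff_X_sq_mul, coeff_expand_mul, coeff_mk, coeff_expand_of_not_dvd _ _ _ (by omega),
      coeff_succ_X_mul, coeff_expand_of_not_dvd _ _ _ (by omega)]
    ring

theorem expand_three_injective {R : Type*} [CommRing R] :
    Function.Injective (expand 3 three_ne_zero : R⟦X⟧ → R⟦X⟧) := by
  intro f g h
  ext n
  rw [← coeff_expand_mul 3 three_ne_zero, h, coeff_expand_mul]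

theorem expand_nine {R : Type*} [CommRing R] (f : R⟦X⟧) :
    expand 9 (by norm_num) f = expand 3 three_ne_zero (expand 3 three_ne_zero f) := by
  rw [← expand_mul]

/-- The norm relation for a series with vanishing third component. -/
theorem cube_add_cube_of_cubeNorm {ω : ℂ} (hω : 1 + ω + ω ^ 2 = 0) {y a b : ℤ⟦X⟧}
    (hy : y = expand 3 three_ne_zero a + X * expand 3 three_ne_zero b)
    (h : cubeNorm ω (map (Int.castRingHom ℂ) y) *
        expand 9 (by norm_num) (map (Int.castRingHom ℂ) y) =
      expand 3 three_ne_zero (map (Int.castRingHom ℂ) y) ^ 4) :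
    (a ^ 3 + X * b ^ 3) * expand 3 three_ne_zero y = y ^ 4 := by
  have h3 : ω ^ 3 = 1 := by linear_combination (ω - 1) * hω
  have h6 : (ω ^ 2) ^ 3 = 1 := by rw [← pow_mul, mul_comm, pow_mul, h3, one_pow]
  have hs : 1 + (C ω : ℂ⟦X⟧) + C ω ^ 2 = 0 := by
    rw [← map_pow, ← map_one (C (R := ℂ)), ← map_add, ← map_add, hω, map_zero]
  have hN : cubeNorm ω (map (Int.castRingHom ℂ) y) =
      expand 3 three_ne_zero (map (Int.castRingHom ℂ) (a ^ 3 + X * b ^ 3)) := by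
    rw [hy, cubeNorm]
    simp only [map_add, map_mul, map_pow, map_expand, map_X, rescale_X, rescale_expand_three h3,
      rescale_expand_three h6, expand_X]
    generalize expand 3 three_ne_zero (map (Int.castRingHom ℂ) a) = A
    generalize expand 3 three_ne_zero (map (Int.castRingHom ℂ) b) = B
    linear_combination (A ^ 2 * X * B + C ω * A * X ^ 2 * B ^ 2 + (C ω - 1) * X ^ 3 * B ^ 3) * hs
  -- Both sides are now series in q³ with coefficients coming from ℤ; q ↦ q³ and ℤ → ℂ are
  -- injective, so the relation descends.
  rw [hN, expand_nine, ← map_mul, ← map_pow, ← map_expand, ← map_mul, ← map_pow] at h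
  exact map_injective _ Int.cast_injective (expand_three_injective h)

theorem coeff_three_mul_thetaPhi (n : ℕ) :
    coeff (3 * n) thetaPhi = coeff n (expand 3 three_ne_zero thetaPhi) := by
  rw [coeff_expand]
  split_ifs with hn
  · obtain ⟨j, rfl⟩ := hn
    rw [Nat.mul_div_cancel_left _ three_pos]
    by_cases hj : IsSquare j
    · obtain ⟨r, rfl⟩ := hj
      rcases r with _ | r
      · rfl
      · rw [← sq, show 3 * (3 * (r + 1) ^ 2) = (3 * (r + 1)) ^ 2 by ring,
          coeff_thetaPhi_sq _ (by omega), coeff_thetaPhi_sq _ (by omega)]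
    · rw [coeff_thetaPhi_of_not_isSquare j hj, coeff_thetaPhi_of_not_isSquare]
      rintro ⟨s, hs⟩
      have h3 : 3 ∣ s := by
        rw [← or_self (3 ∣ s), ← Nat.prime_three.dvd_mul, ← hs]
        exact dvd_mul_right _ _
      obtain ⟨t, rfl⟩ := h3
      exact hj ⟨t, by linarith⟩
  · rw [coeff_thetaPhi_of_not_isSquare]
    rintro ⟨s, hs⟩
    have h3 : 3 ∣ s := by
      rw [← or_self (3 ∣ s), ← Nat.prime_three.dvd_mul, ← hs]
      exact dvd_mul_right _ _
    obtain ⟨t, rfl⟩ := h3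
    exact hn ⟨t * t, by linarith⟩

/-- No square is 2 mod 3, and k² is divisible by 3 only for k = 3j, where k² = 9j² has the parity of
j. -/
theorem thetaPhiNeg_dissection : ∃ b : ℤ⟦X⟧, thetaPhiNeg =
    expand 3 three_ne_zero (expand 3 three_ne_zero thetaPhiNeg) +
      X * expand 3 three_ne_zero b := by
  refine ⟨mk fun n => coeff (3 * n + 1) thetaPhiNeg, ?_⟩
  conv_lhs => rw [eq_expand_three_add thetaPhiNeg]
  have h0 : (mk fun n => coeff (3 * n) thetaPhiNeg) = expand 3 three_ne_zero thetaPhiNeg := by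
    ext n
    rw [coeff_mk, coeff_thetaPhiNeg, coeff_three_mul_thetaPhi, pow_mul, coeff_expand, coeff_expand,
      coeff_thetaPhiNeg]
    split_ifs with hn
    · obtain ⟨j, rfl⟩ := hn
      rw [Nat.mul_div_cancel_left _ three_pos, pow_mul]
      norm_num
    · rw [mul_zero]
  have h2 : (mk fun n => coeff (3 * n + 2) thetaPhiNeg) = 0 := by
    ext n
    rw [coeff_mk, coeff_thetaPhiNeg, coeff_thetaPhi_of_not_isSquare, mul_zero, map_zero]
    rintro ⟨s, hs⟩
    have h : s % 3 = 0 ∨ s % 3 = 1 ∨ s % 3 = 2 := by omega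
    have := congrArg (· % 3) hs
    rcases h with h | h | h <;> simp [Nat.mul_mod, h] at this
  rw [h0, h2, map_zero, mul_zero, add_zero]

theorem triangle_eq_iff {k m : ℕ} : k * (k + 1) / 2 = m ↔ k * (k + 1) = 2 * m := by
  have := (Nat.even_mul_succ_self k).two_dvd
  omega

theorem coeff_three_mul_add_one_thetaPsi (n : ℕ) :
    coeff (3 * n + 1) thetaPsi = coeff n (expand 3 three_ne_zero thetaPsi) := by
  have hmod : ∀ k, k * (k + 1) / 2 = 3 * n + 1 → ∃ i, k = 3 * i + 1 ∧ 3 * (i * (i + 1)) = 2 * n := by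
    intro k hk
    rw [triangle_eq_iff] at hk
    have h : k = 3 * (k / 3) ∨ k = 3 * (k / 3) + 1 ∨ k = 3 * (k / 3) + 2 := by omega
    generalize k / 3 = i at h
    rcases h with rfl | rfl | rfl
    · exfalso
      ring_nf at hk
      omega
    · refine ⟨i, rfl, ?_⟩
      linarith
    · exfalso
      ring_nf at hk
      omega
  rw [coeff_expand]
  split_ifs with hn
  · obtain ⟨j, rfl⟩ := hn
    rw [Nat.mul_div_cancel_left _ three_pos, thetaPsi, coeff_mk, coeff_mk]
    congr 1
    refine Nat.card_congr ⟨fun k => ⟨k.1 / 3, ?_⟩, fun k => ⟨3 * k.1 + 1, ?_⟩, fun k => ?_,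
      fun k => ?_⟩
    · obtain ⟨i, hi, h⟩ := hmod k.1 k.2
      rw [triangle_eq_iff, show k.1 / 3 = i by omega]
      omega
    · have := triangle_eq_iff.1 k.2
      rw [triangle_eq_iff]
      linarith
    · obtain ⟨i, hi, h⟩ := hmod k.1 k.2
      apply Subtype.ext
      change 3 * (k.1 / 3) + 1 = k.1
      omega
    · apply Subtype.ext
      change (3 * k.1 + 1) / 3 = k.1
      omega
  · have : IsEmpty {k : ℕ // k * (k + 1) / 2 = 3 * n + 1} := ⟨fun k => by
      obtain ⟨i, -, h⟩ := hmod k.1 k.2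
      omega⟩
    rw [thetaPsi, coeff_mk]
    simp

/-- No triangular number is 2 mod 3, and the residue 1 occurs only for k = 3i + 1, where the
triangular number is 9 · i(i+1)/2 + 1. -/
theorem thetaPsi_dissection : ∃ a : ℤ⟦X⟧, thetaPsi =
    expand 3 three_ne_zero a +
      X * expand 3 three_ne_zero (expand 3 three_ne_zero thetaPsi) := by
  refine ⟨mk fun n => coeff (3 * n) thetaPsi, ?_⟩
  conv_lhs => rw [eq_expand_three_add thetaPsi]
  have h1 : (mk fun n => coeff (3 * n + 1) thetaPsi) = expand 3 three_ne_zero thetaPsi := by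
    ext n
    rw [coeff_mk, coeff_three_mul_add_one_thetaPsi]
  have h2 : (mk fun n => coeff (3 * n + 2) thetaPsi) = 0 := by
    ext n
    have : IsEmpty {k : ℕ // k * (k + 1) / 2 = 3 * n + 2} := ⟨fun ⟨k, hk⟩ => by
      rw [triangle_eq_iff] at hk
      have h : k = 3 * (k / 3) ∨ k = 3 * (k / 3) + 1 ∨ k = 3 * (k / 3) + 2 := by omega
      generalize k / 3 = i at h
      rcases h with rfl | rfl | rfl <;> ring_nf at hk <;> omega⟩
    rw [coeff_mk, thetaPsi, coeff_mk]
    simp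
  rw [h1, h2, map_zero, mul_zero, add_zero]

end Dissection

/-! ### The trisection operator on polynomials in a cubic Hauptmodul -/

section Trisection

open PowerSeries

/-- The operator `∑ f(n) q ^ n ↦ ∑ f(3n) q ^ n`. -/
noncomputable def trisect : ℤ⟦X⟧ →ₗ[ℤ] ℤ⟦X⟧ where
  toFun f := mk fun n => coeff (3 * n) f
  map_add' f g := by ext n; simp
  map_smul' c f := by
    ext n
    rw [coeff_mk, map_smul, RingHom.id_apply, map_smul, coeff_mk]

theorem coeff_trisect (n : ℕ) (f : ℤ⟦X⟧) : coeff n (trisect f) = coeff (3 * n) f := by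
  simp [trisect]

theorem trisect_expand (f : ℤ⟦X⟧) : trisect (expand 3 three_ne_zero f) = f := by
  ext n
  rw [coeff_trisect, coeff_expand_mul]

theorem trisect_X_mul_expand (f : ℤ⟦X⟧) : trisect (X * expand 3 three_ne_zero f) = 0 := by
  ext n
  rw [coeff_trisect, map_zero]
  rcases n with _ | n
  · simp
  · rw [show 3 * (n + 1) = 3 * n + 2 + 1 by ring, coeff_succ_X_mul,
      coeff_expand_of_not_dvd _ _ _ (by omega)]

theorem trisect_X_sq_mul_expand (f : ℤ⟦X⟧) : trisect (X ^ 2 * expand 3 three_ne_zero f) = 0 := by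
  ext n
  rw [coeff_trisect, map_zero]
  rcases n with _ | n
  · simp
  · rw [show 3 * (n + 1) = 3 * n + 1 + 2 by ring, coeff_X_sq_mul,
      coeff_expand_of_not_dvd _ _ _ (by omega)]

theorem trisect_components (f g h : ℤ⟦X⟧) :
    trisect (expand 3 three_ne_zero f + X * expand 3 three_ne_zero g +
      X ^ 2 * expand 3 three_ne_zero h) = f := by
  rw [map_add, map_add, trisect_expand, trisect_X_mul_expand, trisect_X_sq_mul_expand, add_zero,
    add_zero]

theorem trisect_expand_mul (f g : ℤ⟦X⟧) :
    trisect (expand 3 three_ne_zero f * g) = f * trisect g := by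
  obtain ⟨g0, g1, g2, rfl⟩ : ∃ g0 g1 g2, g = expand 3 three_ne_zero g0 +
    X * expand 3 three_ne_zero g1 + X ^ 2 * expand 3 three_ne_zero g2 :=
    ⟨_, _, _, eq_expand_three_add g⟩
  rw [trisect_components, ← trisect_components (f * g0) (f * g1) (f * g2)]
  simp only [map_mul (expand 3 three_ne_zero)]
  congr 1
  ring

/-- The relations satisfied by both `ξ` and `ζ`: a cubic equation over the series in `q ^ 3`, and
the values of the trisection on the first two powers. -/
structure IsCubicHauptmodul (x : ℤ⟦X⟧) : Prop where
  cube : x ^ 3 = expand 3 three_ne_zero (x - 3 * x ^ 2 + 3 * x ^ 3) * (1 - 3 * x + 3 * x ^ 2)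
  trisect_self : trisect x = x - 3 * x ^ 2 + 3 * x ^ 3
  trisect_sq : trisect (x ^ 2) =
    3 * (x - 3 * x ^ 2 + 3 * x ^ 3) ^ 2 - 2 * (x - 3 * x ^ 2 + 3 * x ^ 3)

theorem IsCubicHauptmodul.trisect_pow_add_three {x : ℤ⟦X⟧} (hx : IsCubicHauptmodul x) (k : ℕ) :
    trisect (x ^ (k + 3)) = (x - 3 * x ^ 2 + 3 * x ^ 3) *
      (trisect (x ^ k) - 3 * trisect (x ^ (k + 1)) + 3 * trisect (x ^ (k + 2))) := by
  have h : x ^ (k + 3) = expand 3 three_ne_zero (x - 3 * x ^ 2 + 3 * x ^ 3) *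
      (x ^ k - (3 : ℤ) • x ^ (k + 1) + (3 : ℤ) • x ^ (k + 2)) := by
    rw [zsmul_eq_mul, zsmul_eq_mul]
    push_cast
    linear_combination x ^ k * hx.cube
  rw [h, trisect_expand_mul, map_add, map_sub, map_smul, map_smul, zsmul_eq_mul, zsmul_eq_mul]
  push_cast
  rfl

/-- `Q` is chosen before `x`: this uniformity is what transfers coefficients from ξ to ζ. The factor
`x` is kept explicit because the even step of the main induction divides by it. -/
theorem exists_trisect_pow_succ (k : ℕ) : ∃ Q : Polynomial ℤ, ∀ x, IsCubicHauptmodul x →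
    trisect (x ^ (k + 1)) = x * Polynomial.aeval x Q := by
  induction k using Nat.strong_induction_on with
  | _ k ih =>
    rcases k with _ | _ | _ | k
    · refine ⟨1 - 3 * Polynomial.X + 3 * Polynomial.X ^ 2, fun x hx => ?_⟩
      simp only [zero_add, pow_one, hx.trisect_self, map_add, map_sub, map_mul, map_pow, map_one,
        map_ofNat, Polynomial.aeval_X]
      ring
    · refine ⟨(1 - 3 * Polynomial.X + 3 * Polynomial.X ^ 2) *
        (3 * (Polynomial.X - 3 * Polynomial.X ^ 2 + 3 * Polynomial.X ^ 3) - 2), fun x hx => ?_⟩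
      simp only [zero_add, Nat.reduceAdd, hx.trisect_sq, map_add, map_sub, map_mul, map_pow,
        map_one, map_ofNat, Polynomial.aeval_X]
      ring
    -- The recurrence here involves U(1) = 1, which is not of the form x · Q(x); the factor x comes
    -- from D = x(1 - 3x + 3x²).
    · obtain ⟨Q0, h0⟩ := ih 0 (by omega)
      obtain ⟨Q1, h1⟩ := ih 1 (by omega)
      refine ⟨(1 - 3 * Polynomial.X + 3 * Polynomial.X ^ 2) *
        (1 - 3 * (Polynomial.X * Q0) + 3 * (Polynomial.X * Q1)), fun x hx => ?_⟩
      have h := hx.trisect_pow_add_three 0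
      have h00 : trisect (x ^ 0) = 1 := by
        rw [pow_zero, ← map_one (expand 3 three_ne_zero : ℤ⟦X⟧ →ₐ[ℤ] ℤ⟦X⟧), trisect_expand]
        simp
      rw [h00, h0 x hx, h1 x hx] at h
      simp only [zero_add, Nat.reduceAdd] at h ⊢
      rw [h]
      simp only [map_add, map_sub, map_mul, map_pow, map_one, map_ofNat, Polynomial.aeval_X]
      ring
    · obtain ⟨Q0, h0⟩ := ih k (by omega)
      obtain ⟨Q1, h1⟩ := ih (k + 1) (by omega)
      obtain ⟨Q2, h2⟩ := ih (k + 2) (by omega)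
      refine ⟨(Polynomial.X - 3 * Polynomial.X ^ 2 + 3 * Polynomial.X ^ 3) *
        (Q0 - 3 * Q1 + 3 * Q2), fun x hx => ?_⟩
      have h := hx.trisect_pow_add_three (k + 1)
      rw [h0 x hx, h1 x hx, h2 x hx] at h
      rw [show k + 1 + 1 + 1 + 1 = k + 1 + 3 by ring, h]
      simp only [map_add, map_sub, map_mul, map_pow, map_ofNat, Polynomial.aeval_X]
      ring

theorem exists_trisect_self_mul_aeval (P : Polynomial ℤ) : ∃ Q : Polynomial ℤ,
    ∀ x, IsCubicHauptmodul x →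
      trisect (x * Polynomial.aeval x P) = x * Polynomial.aeval x Q := by
  induction P using Polynomial.induction_on' with
  | add p q hp hq =>
    obtain ⟨P', hP⟩ := hp
    obtain ⟨Q', hQ⟩ := hq
    refine ⟨P' + Q', fun x hx => ?_⟩
    rw [map_add, mul_add, map_add, hP x hx, hQ x hx, map_add, mul_add]
  | monomial k c =>
    obtain ⟨Q, hQ⟩ := exists_trisect_pow_succ k
    refine ⟨c • Q, fun x hx => ?_⟩
    rw [Polynomial.aeval_monomial, ← Algebra.smul_def, mul_smul_comm, ← pow_succ', map_smul,
      hQ x hx, map_smul, mul_smul_comm]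

theorem exists_trisect_aeval (P : Polynomial ℤ) : ∃ Q : Polynomial ℤ,
    ∀ x, IsCubicHauptmodul x → trisect (Polynomial.aeval x P) = Polynomial.aeval x Q := by
  obtain ⟨Q, hQ⟩ := exists_trisect_self_mul_aeval P.divX
  refine ⟨Polynomial.X * Q + Polynomial.C (P.coeff 0), fun x hx => ?_⟩
  have hC : trisect (algebraMap ℤ ℤ⟦X⟧ (P.coeff 0)) = algebraMap ℤ ℤ⟦X⟧ (P.coeff 0) := by
    rw [← AlgHom.commutes (expand 3 three_ne_zero : ℤ⟦X⟧ →ₐ[ℤ] ℤ⟦X⟧), trisect_expand]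
    simp
  conv_lhs => rw [← Polynomial.X_mul_divX_add P]
  simp only [map_add, map_mul, Polynomial.aeval_X, Polynomial.aeval_C, hQ x hx, hC]

theorem aeval_eq_zero_of_constantCoeff_eq_zero {t : ℤ⟦X⟧} (h0 : constantCoeff t = 0) (ht : t ≠ 0)
    (P : Polynomial ℤ) : Polynomial.aeval t P = 0 → P = 0 := by
  induction P using Polynomial.recOnHorner with
  | M0 => intro _; rfl
  | MC p a hp ha ih =>
    intro h
    obtain ⟨r, rfl⟩ := Polynomial.X_dvd_iff.2 hp
    have := congrArg constantCoeff h
    simp [h0] at this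
    exact absurd this ha
  | MX p hp ih =>
    intro h
    rw [map_mul, Polynomial.aeval_X, mul_eq_zero, or_iff_left ht] at h
    rw [ih h, zero_mul]

/-- Translating by the constant term reduces to a nonzero t without constant term; there the
constant coefficient of a relation must vanish and a factor t can be cancelled, repeatedly. -/
theorem aeval_injective_of_ne_C {x : ℤ⟦X⟧} (hx : x ≠ C (constantCoeff x)) :
    Function.Injective (Polynomial.aeval x : Polynomial ℤ → ℤ⟦X⟧) := by
  rw [injective_iff_map_eq_zero]
  intro P hP
  have h := aeval_eq_zero_of_constantCoeff_eq_zero (t := x - C (constantCoeff x)) (by simp)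
    (sub_ne_zero.2 hx) (P.comp (Polynomial.X + Polynomial.C (constantCoeff x)))
  rw [Polynomial.aeval_comp, map_add, Polynomial.aeval_X, Polynomial.aeval_C,
    ← PowerSeries.C_eq_algebraMap, sub_add_cancel] at h
  exact (Polynomial.comp_X_add_C_eq_zero_iff).1 (h hP)

end Trisection

/-! ### The relations for ξ and ζ, and the induction on M -/

section Hauptmoduln

open PowerSeries

theorem isCubicHauptmodul_of_left {x y a b : ℤ⟦X⟧} (hy0 : y ≠ 0)
    (hy : y = expand 3 three_ne_zero a + X * expand 3 three_ne_zero b)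
    (ha : expand 3 three_ne_zero y = a)
    (hn : (a ^ 3 + X * b ^ 3) * expand 3 three_ne_zero y = y ^ 4)
    (hx : x * y = expand 3 three_ne_zero a) : IsCubicHauptmodul x := by
  have hn0 : a ^ 3 + X * b ^ 3 ≠ 0 := fun h => by
    rw [h, zero_mul] at hn
    exact pow_ne_zero 4 hy0 hn.symm
  have ha0 : a ≠ 0 := fun h => by
    rw [ha, h, mul_zero] at hn
    exact pow_ne_zero 4 hy0 hn.symm
  have hN := congrArg (expand 3 three_ne_zero) hn
  rw [map_mul, map_pow, ha] at hN
  have hN' : expand 3 three_ne_zero (a ^ 3 + X * b ^ 3) = (expand 3 three_ne_zero a) ^ 3 +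
      X ^ 3 * (expand 3 three_ne_zero b) ^ 3 := by
    simp only [map_add, map_mul, map_pow, expand_X]
  have hN0 : expand 3 three_ne_zero (a ^ 3 + X * b ^ 3) ≠ 0 := fun h => hn0 <| by
    apply expand_three_injective
    rw [h, map_zero]
  -- Write A = a(q³), B = b(q³), N = a³ + q b³. From x = A/y and 1 - x = qB/y, D = x(x³ + (1 - x)³)
  -- = A(A³ + q³B³)/y⁴; the norm relation at q and at q³ turns this into a³/N.
  have hD : (x - 3 * x ^ 2 + 3 * x ^ 3) * (a ^ 3 + X * b ^ 3) = a ^ 3 := by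
    apply mul_right_cancel₀ ha0
    rw [ha] at hn
    rw [mul_assoc, hn, ← pow_succ, ← hN, hN']
    generalize expand 3 three_ne_zero a = A at *
    generalize expand 3 three_ne_zero b = B at *
    rw [show (x - 3 * x ^ 2 + 3 * x ^ 3) * y ^ 4 =
      (x * y) * y ^ 3 - 3 * (x * y) ^ 2 * y ^ 2 + 3 * (x * y) ^ 3 * y by ring, hx, hy]
    ring
  have hED := congrArg (expand 3 three_ne_zero) hD
  rw [map_mul, map_pow] at hED
  refine ⟨?_, ?_, ?_⟩
  · apply mul_right_cancel₀ (mul_ne_zero hN0 (pow_ne_zero 3 hy0))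
    rw [show ∀ e : ℤ⟦X⟧, e * (1 - 3 * x + 3 * x ^ 2) *
      (expand 3 three_ne_zero (a ^ 3 + X * b ^ 3) * y ^ 3) =
      e * expand 3 three_ne_zero (a ^ 3 + X * b ^ 3) *
        (y ^ 3 - 3 * (x * y) * y ^ 2 + 3 * (x * y) ^ 2 * y) by intro e; ring, hED, hN',
      show ∀ n : ℤ⟦X⟧, x ^ 3 * (n * y ^ 3) = n * (x * y) ^ 3 by intro n; ring, hx, hy]
    ring
  · apply mul_left_cancel₀ hn0
    -- Since 1/y = (A² - qAB + q²B²)/(A³ + q³B³), x acquires a denominator in q³ and its three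
    -- components can be read off.
    have hc : expand 3 three_ne_zero (a ^ 3 + X * b ^ 3) * x = expand 3 three_ne_zero (a ^ 3) +
        X * expand 3 three_ne_zero (-(a ^ 2 * b)) + X ^ 2 * expand 3 three_ne_zero (a * b ^ 2) := by
      rw [hN']
      simp only [map_mul, map_pow, map_neg]
      linear_combination ((expand 3 three_ne_zero a) ^ 2 -
        X * expand 3 three_ne_zero a * expand 3 three_ne_zero b +
        X ^ 2 * (expand 3 three_ne_zero b) ^ 2) * (hx - x * hy)
    exact (trisect_expand_mul _ _).symm.trans <| by
      rw [hc, trisect_components, mul_comm _ (x - _ + _), hD]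
  -- Squaring that expression gives U(x²) = (a⁶ - 2q a³b³)/N². As D = a³/N and 1 - D = q b³/N, this
  -- is D² - 2D(1 - D) = 3D² - 2D.
  · apply mul_left_cancel₀ (pow_ne_zero 2 hn0)
    rw [← trisect_expand_mul, show ∀ d n : ℤ⟦X⟧, n ^ 2 * (3 * d ^ 2 - 2 * d) =
      3 * (d * n) ^ 2 - 2 * (d * n) * n by intro d n; ring, hD,
      show 3 * (a ^ 3) ^ 2 - 2 * a ^ 3 * (a ^ 3 + X * b ^ 3) = a ^ 6 - 2 * X * a ^ 3 * b ^ 3 by ring,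
      ← trisect_components (a ^ 6 - 2 * X * a ^ 3 * b ^ 3) (-2 * a ^ 5 * b + X * a ^ 2 * b ^ 4)
        (3 * a ^ 4 * b ^ 2), map_pow, hN']
    congr 1
    simp only [map_mul, map_pow, map_neg, map_add, map_sub, map_ofNat, expand_X]
    generalize expand 3 three_ne_zero a = A at *
    generalize expand 3 three_ne_zero b = B at *
    rw [show A ^ 3 + X ^ 3 * B ^ 3 = y * (A ^ 2 - X * A * B + X ^ 2 * B ^ 2) by rw [hy]; ring,
      show ∀ w : ℤ⟦X⟧, (y * w) ^ 2 * x ^ 2 = (x * y) ^ 2 * w ^ 2 by intro w; ring, hx]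
    ring

/-- The mirror image of `isCubicHauptmodul_of_left`: now x = qB/y and 1 - x = A/y, so D = q b³/N and
1 - D = a³/N. The symmetry of x³ + (1 - x)³ and of D(1 - D) keeps the relations unchanged. -/
theorem isCubicHauptmodul_of_right {x y a b : ℤ⟦X⟧} (hy0 : y ≠ 0)
    (hy : y = expand 3 three_ne_zero a + X * expand 3 three_ne_zero b)
    (hb : expand 3 three_ne_zero y = b)
    (hn : (a ^ 3 + X * b ^ 3) * expand 3 three_ne_zero y = y ^ 4)
    (hx : x * y = X * expand 3 three_ne_zero b) : IsCubicHauptmodul x := by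
  have hn0 : a ^ 3 + X * b ^ 3 ≠ 0 := fun h => by
    rw [h, zero_mul] at hn
    exact pow_ne_zero 4 hy0 hn.symm
  have hb0 : b ≠ 0 := fun h => by
    rw [hb, h, mul_zero] at hn
    exact pow_ne_zero 4 hy0 hn.symm
  have hN := congrArg (expand 3 three_ne_zero) hn
  rw [map_mul, map_pow, hb] at hN
  have hN' : expand 3 three_ne_zero (a ^ 3 + X * b ^ 3) = (expand 3 three_ne_zero a) ^ 3 +
      X ^ 3 * (expand 3 three_ne_zero b) ^ 3 := by
    simp only [map_add, map_mul, map_pow, expand_X]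
  have hN0 : expand 3 three_ne_zero (a ^ 3 + X * b ^ 3) ≠ 0 := fun h => hn0 <| by
    apply expand_three_injective
    rw [h, map_zero]
  have hD : (x - 3 * x ^ 2 + 3 * x ^ 3) * (a ^ 3 + X * b ^ 3) = X * b ^ 3 := by
    apply mul_right_cancel₀ hb0
    rw [hb] at hn
    rw [mul_assoc, hn, mul_assoc, ← pow_succ, ← hN, hN']
    generalize expand 3 three_ne_zero a = A at *
    generalize expand 3 three_ne_zero b = B at *
    rw [show (x - 3 * x ^ 2 + 3 * x ^ 3) * y ^ 4 =
      (x * y) * y ^ 3 - 3 * (x * y) ^ 2 * y ^ 2 + 3 * (x * y) ^ 3 * y by ring, hx, hy]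
    ring
  have hED := congrArg (expand 3 three_ne_zero) hD
  rw [map_mul, map_mul, map_pow, expand_X] at hED
  refine ⟨?_, ?_, ?_⟩
  · apply mul_right_cancel₀ (mul_ne_zero hN0 (pow_ne_zero 3 hy0))
    rw [show ∀ e : ℤ⟦X⟧, e * (1 - 3 * x + 3 * x ^ 2) *
      (expand 3 three_ne_zero (a ^ 3 + X * b ^ 3) * y ^ 3) =
      e * expand 3 three_ne_zero (a ^ 3 + X * b ^ 3) *
        (y ^ 3 - 3 * (x * y) * y ^ 2 + 3 * (x * y) ^ 2 * y) by intro e; ring, hED, hN',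
      show ∀ n : ℤ⟦X⟧, x ^ 3 * (n * y ^ 3) = n * (x * y) ^ 3 by intro n; ring, hx, hy]
    ring
  · apply mul_left_cancel₀ hn0
    have hc : expand 3 three_ne_zero (a ^ 3 + X * b ^ 3) * x = expand 3 three_ne_zero (X * b ^ 3) +
        X * expand 3 three_ne_zero (a ^ 2 * b) + X ^ 2 * expand 3 three_ne_zero (-(a * b ^ 2)) := by
      rw [hN']
      simp only [map_mul, map_pow, map_neg, expand_X]
      linear_combination ((expand 3 three_ne_zero a) ^ 2 -
        X * expand 3 three_ne_zero a * expand 3 three_ne_zero b +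
        X ^ 2 * (expand 3 three_ne_zero b) ^ 2) * (hx - x * hy)
    exact (trisect_expand_mul _ _).symm.trans <| by
      rw [hc, trisect_components, mul_comm _ (x - _ + _), hD]
  · apply mul_left_cancel₀ (pow_ne_zero 2 hn0)
    rw [← trisect_expand_mul, show ∀ d n : ℤ⟦X⟧, n ^ 2 * (3 * d ^ 2 - 2 * d) =
      3 * (d * n) ^ 2 - 2 * (d * n) * n by intro d n; ring, hD,
      show 3 * (X * b ^ 3) ^ 2 - 2 * (X * b ^ 3) * (a ^ 3 + X * b ^ 3) =
        X ^ 2 * b ^ 6 - 2 * X * a ^ 3 * b ^ 3 by ring,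
      ← trisect_components (X ^ 2 * b ^ 6 - 2 * X * a ^ 3 * b ^ 3) (3 * X * a ^ 2 * b ^ 4)
        (a ^ 4 * b ^ 2 - 2 * X * a * b ^ 5), map_pow, hN']
    congr 1
    simp only [map_mul, map_pow, map_sub, map_ofNat, expand_X]
    generalize expand 3 three_ne_zero a = A at *
    generalize expand 3 three_ne_zero b = B at *
    rw [show A ^ 3 + X ^ 3 * B ^ 3 = y * (A ^ 2 - X * A * B + X ^ 2 * B ^ 2) by rw [hy]; ring,
      show ∀ w : ℤ⟦X⟧, (y * w) ^ 2 * x ^ 2 = (x * y) ^ 2 * w ^ 2 by intro w; ring, hx]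
    ring

theorem ne_zero_of_constantCoeff_eq_one {f : ℤ⟦X⟧} (h : constantCoeff f = 1) : f ≠ 0 := by
  rintro rfl
  simp at h

theorem subst9_eq (f : ℤ⟦X⟧) : subst9 f = subst3 (subst3 f) :=
  expand_nine f

theorem constantCoeff_subst3 (f : ℤ⟦X⟧) : constantCoeff (subst3 f) = constantCoeff f :=
  constantCoeff_expand 3 three_ne_zero f

theorem serXi_mul_thetaPhiNeg : serXi * thetaPhiNeg = subst3 (subst3 thetaPhiNeg) := by
  rw [serXi, psDiv_mul_cancel _ _ constantCoeff_thetaPhiNeg, subst9_eq]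

theorem serZeta_mul_thetaPsi : serZeta * thetaPsi = X * subst3 (subst3 thetaPsi) := by
  rw [serZeta, mul_assoc, psDiv_mul_cancel _ _ constantCoeff_thetaPsi, subst9_eq]

theorem isCubicHauptmodul_serXi : IsCubicHauptmodul serXi := by
  obtain ⟨ω, hω⟩ := exists_one_add_add_sq_eq_zero
  obtain ⟨b, hb⟩ := thetaPhiNeg_dissection
  exact isCubicHauptmodul_of_left (ne_zero_of_constantCoeff_eq_one constantCoeff_thetaPhiNeg) hb
    rfl (cube_add_cube_of_cubeNorm hω hb (cubeNorm_thetaPhiNeg hω)) serXi_mul_thetaPhiNeg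

theorem isCubicHauptmodul_serZeta : IsCubicHauptmodul serZeta := by
  obtain ⟨ω, hω⟩ := exists_one_add_add_sq_eq_zero
  obtain ⟨a, ha⟩ := thetaPsi_dissection
  exact isCubicHauptmodul_of_right (ne_zero_of_constantCoeff_eq_one constantCoeff_thetaPsi) ha
    rfl (cube_add_cube_of_cubeNorm hω ha (cubeNorm_thetaPsi hω)) serZeta_mul_thetaPsi

theorem mul_subst3_psDiv (y : ℤ⟦X⟧) (hy : constantCoeff y = 1) :
    psDiv (subst3 y) y * subst3 (psDiv (subst3 y) y) * y = subst3 (subst3 y) := by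
  have h := psDiv_mul_cancel (subst3 y) y hy
  have h' : subst3 (psDiv (subst3 y) y) * subst3 y = subst3 (subst3 y) :=
    (map_mul (expand 3 three_ne_zero) _ _).symm.trans (congrArg subst3 h)
  linear_combination h' + subst3 (psDiv (subst3 y) y) * h

theorem serF_mul_subst3_serF : serF * subst3 serF = serXi := by
  apply mul_right_cancel₀ (ne_zero_of_constantCoeff_eq_one constantCoeff_thetaPhiNeg)
  rw [serXi_mul_thetaPhiNeg]
  exact mul_subst3_psDiv _ constantCoeff_thetaPhiNeg

theorem X_mul_serG_mul_subst3_serG : X * serG * subst3 serG = serZeta := by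
  apply mul_right_cancel₀ (ne_zero_of_constantCoeff_eq_one constantCoeff_thetaPsi)
  rw [serZeta_mul_thetaPsi, mul_assoc, mul_assoc, ← mul_assoc serG]
  exact congrArg (X * ·) (mul_subst3_psDiv _ constantCoeff_thetaPsi)

theorem aeval_serXi_injective :
    Function.Injective (Polynomial.aeval serXi : Polynomial ℤ → ℤ⟦X⟧) := by
  apply aeval_injective_of_ne_C
  have hc : constantCoeff serXi = 1 := by
    rw [serXi, constantCoeff_psDiv, subst9_eq, constantCoeff_subst3, constantCoeff_subst3,
      constantCoeff_thetaPhiNeg]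
  rw [hc, map_one]
  intro h
  -- If ξ were 1, then φ(-q) = φ(-q⁹), but the coefficients of q are -2 and 0.
  have h1 := congrArg (coeff 1) serXi_mul_thetaPhiNeg
  rw [h, one_mul, subst3, coeff_expand_of_not_dvd _ _ _ (by norm_num), coeff_thetaPhiNeg,
    show coeff 1 thetaPhi = 2 from coeff_thetaPhi_sq 1 one_ne_zero] at h1
  norm_num at h1

theorem trisect_subst3_mul (f g : ℤ⟦X⟧) : trisect (subst3 f * g) = f * trisect g :=
  trisect_expand_mul f g

theorem trisect_mk_ph3 (M : ℕ) :
    trisect (mk fun n => ph3 (3 ^ M * n)) = mk fun n => ph3 (3 ^ (M + 1) * n) := by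
  ext n
  rw [coeff_trisect, coeff_mk, coeff_mk, pow_succ, mul_assoc]

theorem trisect_mk_ps3_of_odd {M : ℕ} (hM : ¬ Even M) :
    trisect (mk fun n => ps3 (3 ^ M * n + (3 ^ (2 * ((M + 1) / 2)) - 1) / 4)) =
      mk fun n => ps3 (3 ^ (M + 1) * n + (3 ^ (2 * ((M + 1 + 1) / 2)) - 1) / 4) := by
  rw [Nat.not_even_iff] at hM
  ext n
  rw [coeff_trisect, coeff_mk, coeff_mk, show (M + 1 + 1) / 2 = (M + 1) / 2 by omega, pow_succ 3 M,
    mul_assoc]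

theorem trisect_X_mul_mk_ps3_of_even {M : ℕ} (hM : Even M) :
    trisect (X * mk fun n => ps3 (3 ^ M * n + (3 ^ (2 * ((M + 1) / 2)) - 1) / 4)) =
      X * mk fun n => ps3 (3 ^ (M + 1) * n + (3 ^ (2 * ((M + 1 + 1) / 2)) - 1) / 4) := by
  rw [Nat.even_iff] at hM
  ext n
  rw [coeff_trisect]
  rcases n with _ | n
  · simp
  rw [show 3 * (n + 1) = 3 * n + 2 + 1 by ring, coeff_succ_X_mul, coeff_succ_X_mul, coeff_mk,
    coeff_mk, show 2 * ((M + 1) / 2) = M by omega, show 2 * ((M + 1 + 1) / 2) = M + 2 by omega]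
  congr 1
  -- This makes (3^M - 1)/4 exact, so that 2 · 3^M + (3^M - 1)/4 = (3^(M+2) - 1)/4; the 2 · 3^M
  -- comes from the index 3n + 2 produced by the shift by `X`.
  have h4 : 3 ^ M % 4 = 1 := by
    rw [show M = 2 * (M / 2) by omega, pow_mul, Nat.pow_mod]
    norm_num
  have h : 3 ^ (M + 1) * n = 3 * (3 ^ M * n) := by ring
  rw [h, mul_add, pow_add]
  have h' : 3 ^ M * (3 * n) = 3 * (3 ^ M * n) := by ring
  rw [h']
  omega

/-- The series of `ph3` and `ps3` along the progressions are given by the same polynomials in `ξ`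
and `ζ`. -/
theorem exists_common_polynomial (M : ℕ) : ∃ Q : Polynomial ℤ,
    (mk fun n => ph3 (3 ^ M * n)) =
      (if Even M then serF else subst3 serF) * Polynomial.aeval serXi Q ∧
    (mk fun n => ps3 (3 ^ M * n + (3 ^ (2 * ((M + 1) / 2)) - 1) / 4)) =
      (if Even M then serG else subst3 serG) * Polynomial.aeval serZeta Q := by
  induction M with
  | zero => exact ⟨1, by ext n; simp [ph3], by ext n; simp [ps3]⟩
  | succ M ih =>
    obtain ⟨P, h1, h2⟩ := ih
    by_cases hM : Even M
    · have hM' : ¬ Even (M + 1) := by rwa [Nat.even_add_one, not_not]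
      obtain ⟨Q, hQ⟩ := exists_trisect_self_mul_aeval P
      refine ⟨Q, ?_, ?_⟩
      · rw [if_pos hM] at h1
        rw [if_neg hM', ← trisect_mk_ph3]
        -- The factor F becomes F(q³) inside U and completes F P(ξ) to ξ P(ξ); the resulting ξ Q(ξ)
        -- = F F(q³) Q(ξ) then gives F back.
        apply mul_left_cancel₀ (ne_zero_of_constantCoeff_eq_one constantCoeff_serF)
        rw [← trisect_subst3_mul, h1, ← mul_assoc, ← mul_assoc, mul_comm (subst3 serF),
          serF_mul_subst3_serF, hQ _ isCubicHauptmodul_serXi]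
      · rw [if_pos hM] at h2
        rw [if_neg hM']
        -- The extra q in ζ = q G(q) G(q³) is what moves the offset of the progression at this step.
        apply mul_left_cancel₀ (X_ne_zero (R := ℤ))
        apply mul_left_cancel₀ (ne_zero_of_constantCoeff_eq_one constantCoeff_serG)
        rw [← trisect_X_mul_mk_ps3_of_even hM, ← trisect_subst3_mul, h2,
          show subst3 serG * (X * (serG * Polynomial.aeval serZeta P)) =
            X * serG * subst3 serG * Polynomial.aeval serZeta P by ring,
          X_mul_serG_mul_subst3_serG, hQ _ isCubicHauptmodul_serZeta, ← X_mul_serG_mul_subst3_serG]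
        ring
    · have hM' : Even (M + 1) := by rwa [Nat.even_add_one]
      obtain ⟨Q, hQ⟩ := exists_trisect_aeval P
      refine ⟨Q, ?_, ?_⟩
      · rw [if_neg hM] at h1
        rw [if_pos hM', ← trisect_mk_ph3, h1, trisect_subst3_mul, hQ _ isCubicHauptmodul_serXi]
      · rw [if_neg hM] at h2
        rw [if_pos hM', ← trisect_mk_ps3_of_odd hM, h2, trisect_subst3_mul,
          hQ _ isCubicHauptmodul_serZeta]

theorem psDiv_eq_of_eq_mul {f g r : ℤ⟦X⟧} (hg : constantCoeff g = 1) (h : f = g * r) :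
    psDiv f g = r := by
  apply mul_right_cancel₀ (ne_zero_of_constantCoeff_eq_one hg)
  rw [psDiv_mul_cancel f g hg, h, mul_comm]

end Hauptmoduln

theorem theorem5p2 (M : ℕ) (hM : 1 ≤ M) :
    (∃! P : Polynomial ℤ, serPhi M = Polynomial.aeval serXi P) ∧
      ∀ P : Polynomial ℤ, serPhi M = Polynomial.aeval serXi P →
        serPsi M = Polynomial.aeval serZeta P := by
  obtain ⟨Q, h1, h2⟩ := exists_common_polynomial M
  have hF : PowerSeries.constantCoeff (if Even M then serF else subst3 serF) = 1 := by
    split_ifs <;> simp only [constantCoeff_subst3, constantCoeff_serF]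
  have hG : PowerSeries.constantCoeff (if Even M then serG else subst3 serG) = 1 := by
    split_ifs <;> simp only [constantCoeff_subst3, constantCoeff_serG]
  have e1 : serPhi M = Polynomial.aeval serXi Q := psDiv_eq_of_eq_mul hF h1
  have e2 : serPsi M = Polynomial.aeval serZeta Q := psDiv_eq_of_eq_mul hG h2
  refine ⟨⟨Q, e1, fun P hP => aeval_serXi_injective (hP.symm.trans e1)⟩, fun P hP => ?_⟩
  rw [e2, aeval_serXi_injective (hP.symm.trans e1)]
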